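/- Let $n\ge 2$ be an integer. Let $\Gamma(\mathbb{Z}_n)$ be the zero divisor graph of the ring $\mathbb{Z}_n$ of integers modulo $n$: its vertices are the nonzero $x\in\mathbb{Z}_n$ for which there is a nonzero $y\in\mathbb{Z}_n$ with $xy=0$, and two distinct vertices $x,y$ are adjacent if and only if $xy=0$. Let $\Upsilon_n$ be the simple graph whose vertices are the divisors $d$ of $n$ with $1<d<n$, two distinct vertices $d,e$ being adjacent (written $d\sim e$) if and only if $n\mid de$. Let $\mathbf{L}(\Upsilon_n)$ be the matrix, indexed by the vertices of $\Upsilon_n$, with diagonal entries $\mathbf{L}(\Upsilon_n)_{d,d}=\sum_{e\sim d}\phi(n/e)$ and, for $d\neq e$, entries $\mathbf{L}(\Upsilon_n)_{d,e}=-\phi(n/e)$ if $d\sim e$ and $0$ otherwise, where $\phi$ is Euler's totient function. The algebraic connectivity and the Laplacian spectral radius of a finite simple graph are the second smallest and the largest eigenvalue, respectively, of its Laplacian matrix (the diagonal matrix of vertex degrees minus the adjacency matrix); eigenvalues are counted with multiplicity. If $n$ is not a power of a prime, then all eigenvalues of $\mathbf{L}(\Upsilon_n)$ are real, and the following hold.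 (i) If $n$ is neither a prime power nor a product of two distinct primes, then the algebraic connectivity of $\Gamma(\mathbb{Z}_n)$ equals the second smallest eigenvalue of $\mathbf{L}(\Upsilon_n)$. (ii) If $n$ is not a prime power, then the Laplacian spectral radius of $\Gamma(\mathbb{Z}_n)$ equals the largest eigenvalue of $\mathbf{L}(\Upsilon_n)$. -/

import Mathlib

/-- A zero divisor of `R`: a nonzero `x` that is annihilated by some nonzero `y`. -/
abbrev ZeroDivisor (R : Type*) [CommRing R] : Type _ :=
  {x : R // x ≠ 0 ∧ ∃ y : R, y ≠ 0 ∧ x * y = 0}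

/-- The zero divisor graph `Γ(R)`: the vertices are the zero divisors of `R`, and two distinct
vertices are adjacent if and only if their product is zero. -/
def zeroDivisorGraph (R : Type*) [CommRing R] : SimpleGraph (ZeroDivisor R) where
  Adj x y := x ≠ y ∧ (x : R) * (y : R) = 0
  symm := ⟨fun x y h => ⟨h.1.symm, by rw [mul_comm]; exact h.2⟩⟩
  loopless := ⟨fun _ h => h.1 rfl⟩

instance (R : Type*) [CommRing R] [DecidableEq R] :
    DecidableRel (zeroDivisorGraph R).Adj :=
  fun x y => inferInstanceAs (Decidable (x ≠ y ∧ (x : R) * (y : R) = 0))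

/-- A divisor `d` of `n` with `1 < d < n`. -/
abbrev ProperDivisor (n : ℕ) : Type :=
  {d : ℕ // d ∈ (Finset.Ioo 1 n).filter (fun d => d ∣ n)}

/-- The graph `Υ_n` on the proper divisors of `n`: two distinct vertices `d`, `e` are adjacent
if and only if `n` divides `d * e`. -/
def divisorGraph (n : ℕ) : SimpleGraph (ProperDivisor n) where
  Adj d e := d ≠ e ∧ n ∣ (d : ℕ) * (e : ℕ)
  symm := ⟨fun d e h => ⟨h.1.symm, by rw [mul_comm]; exact h.2⟩⟩
  loopless := ⟨fun _ h => h.1 rfl⟩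

instance (n : ℕ) : DecidableRel (divisorGraph n).Adj :=
  fun d e => inferInstanceAs (Decidable (d ≠ e ∧ n ∣ (d : ℕ) * (e : ℕ)))

/-- The vertex weighted Laplacian matrix of a graph `G` with vertex weights `m`. -/
def weightedLaplacian {V : Type*} [Fintype V] [DecidableEq V] (G : SimpleGraph V)
    [DecidableRel G.Adj] (m : V → ℝ) : Matrix V V ℝ :=
  Matrix.of fun i j =>
    if i = j then ∑ r ∈ G.neighborFinset i, m r
    else if G.Adj i j then -m j
    else 0

/-- The matrix `𝐋(Υ_n)`: the vertex `d` of `Υ_n` has weight `φ(n / d)`. -/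
def divisorLaplacian (n : ℕ) : Matrix (ProperDivisor n) (ProperDivisor n) ℝ :=
  weightedLaplacian (divisorGraph n) fun d => ((n / (d : ℕ)).totient : ℝ)

/-- All the (complex) eigenvalues of `A` are real, and `x` is the second smallest of them, counted
with multiplicity. -/
def IsSecondSmallestEigenvalue {V : Type*} [Fintype V] [DecidableEq V] (A : Matrix V V ℝ)
    (x : ℝ) : Prop :=
  A.charpoly.Splits ∧ (A.charpoly.roots.sort (· ≤ ·))[1]? = some x

/-- All the (complex) eigenvalues of `A` are real, and `x` is the largest of them. -/
def IsLargestEigenvalue {V : Type*} [Fintype V] [DecidableEq V] (A : Matrix V V ℝ)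
    (x : ℝ) : Prop :=
  A.charpoly.Splits ∧ IsGreatest {y | y ∈ A.charpoly.roots} x

/-- `x` is the algebraic connectivity of `G`. -/
def IsAlgebraicConnectivity {V : Type*} [Fintype V] [DecidableEq V] (G : SimpleGraph V)
    [DecidableRel G.Adj] (x : ℝ) : Prop :=
  IsSecondSmallestEigenvalue (G.lapMatrix ℝ) x

/-- `x` is the Laplacian spectral radius of `G`. -/
def IsLaplacianSpectralRadius {V : Type*} [Fintype V] [DecidableEq V] (G : SimpleGraph V)
    [DecidableRel G.Adj] (x : ℝ) : Prop :=
  IsLargestEigenvalue (G.lapMatrix ℝ) x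

/-! Sorting zero divisors by `gcd(n, x)` gives classes indexed by the proper divisors `d`, of size
`φ(n/d)`, and adjacency of distinct vertices depends only on their classes. Functions constant on
classes are therefore preserved by the Laplacian, which acts on them as `𝐋(Υ_n)`. Conversely,
averaging an eigenvector over classes gives an eigenvector of `𝐋(Υ_n)` with the same eigenvalue,
unless all class sums vanish; the eigenvalue is then `k(d)`, the total weight of the classes related
to some `d` (`eigenvector_descends_or`).

It remains to see that these `k(d)` disturb neither extreme, using Rayleigh quotients for the inner
product weighted by `m d = φ(n/d)`, in which `𝐋(Υ_n)` is self-adjoint; this also makes its spectrum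
real. At the top, a test vector on the star at `d` gives an eigenvalue at least `m d` plus the
weight of its neighbours, hence at least `k(d)` (`weight_closed_neighbourhood_le`). At the bottom,
the least prime `p` of `n` has `n/p` as its only neighbour, so the second smallest eigenvalue is at
most `φ(p) = p - 1` (`le_weight_of_unique_neighbour`), while every `k(d)` is at least `p - 1`
(`totient_minFac_le_sum_totient`). -/

open Matrix

/-! ### Spectral theory of matrices in detailed balance -/

section Reversible

variable {V : Type*} [Fintype V]

theorem weighted_self_adjoint {A : Matrix V V ℝ} {m : V → ℝ}
    (hA : ∀ i j, m i * A i j = m j * A j i) (f g : V → ℝ) :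
    ∑ a, m a * (f a * (A *ᵥ g) a) = ∑ a, m a * ((A *ᵥ f) a * g a) := by
  simp only [mulVec, dotProduct, Finset.mul_sum, Finset.sum_mul]
  rw [Finset.sum_comm]
  refine Finset.sum_congr rfl fun a _ => Finset.sum_congr rfl fun b _ => ?_
  linear_combination (f b * g a) * hA b a

theorem weighted_form_eq {A : Matrix V V ℝ} {m : V → ℝ}
    (hA : ∀ i j, m i * A i j = m j * A j i) {ev : V → ℝ} {u : V → V → ℝ}
    (hu : ∀ i, A *ᵥ u i = ev i • u i)
    (hP : ∀ f g : V → ℝ, ∑ i, (∑ a, m a * (f a * u i a)) * (∑ a, m a * (u i a * g a)) =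
        ∑ a, m a * (f a * g a)) (f : V → ℝ) :
    ∑ a, m a * (f a * (A *ᵥ f) a) = ∑ i, ev i * (∑ a, m a * (f a * u i a)) ^ 2 := by
  rw [← hP]
  refine Finset.sum_congr rfl fun i _ => ?_
  rw [weighted_self_adjoint hA, hu, pow_two]
  have : ∑ a, m a * ((ev i • u i) a * f a) = ev i * ∑ a, m a * (f a * u i a) := by
    rw [Finset.mul_sum]
    exact Finset.sum_congr rfl fun a _ => by simp only [Pi.smul_apply, smul_eq_mul]; ring
  rw [this]; ring

variable [DecidableEq V]

/-- A matrix satisfying the detailed balance condition for positive weights `m` has a basis of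
eigenvectors that is orthonormal for the weighted inner product. -/
theorem exists_weighted_eigenbasis {A : Matrix V V ℝ} {m : V → ℝ} (hm : ∀ i, 0 < m i)
    (hA : ∀ i j, m i * A i j = m j * A j i) :
    ∃ (ev : V → ℝ) (u : V → V → ℝ), A.charpoly.Splits ∧
      A.charpoly.roots = Finset.univ.val.map ev ∧
      (∀ i, A *ᵥ u i = ev i • u i) ∧
      (∀ i j, ∑ a, m a * (u i a * u j a) = if i = j then 1 else 0) ∧
      (∀ f g : V → ℝ, ∑ i, (∑ a, m a * (f a * u i a)) * (∑ a, m a * (u i a * g a)) =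
        ∑ a, m a * (f a * g a)) := by
  have hs : ∀ i, 0 < √(m i) := fun i => Real.sqrt_pos.mpr (hm i)
  have hs0 : ∀ i, √(m i) ≠ 0 := fun i => (hs i).ne'
  have hss : ∀ i, √(m i) * √(m i) = m i := fun i => Real.mul_self_sqrt (hm i).le
  -- Conjugating by `diag(√m)` makes `A` symmetric, so the ordinary spectral theorem applies.
  set D : (Matrix V V ℝ)ˣ :=
    ⟨diagonal fun i => √(m i), diagonal fun i => (√(m i))⁻¹,
      by simp [hs0], by simp [hs0]⟩ with hD
  set S : Matrix V V ℝ := D.val * A * D⁻¹.val with hS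
  have hSapp : ∀ i j, S i j = √(m i) * A i j * (√(m j))⁻¹ := by
    intro i j
    change (diagonal (fun i => √(m i)) * A * diagonal fun i => (√(m i))⁻¹) i j = _
    rw [mul_diagonal, diagonal_mul]
  have hSH : S.IsHermitian := by
    ext i j
    simp only [conjTranspose_apply, star_trivial, hSapp]
    have h := hA i j
    rw [← hss i, ← hss j] at h
    field_simp [hs0 i, hs0 j]
    linear_combination -h
  have hchar : S.charpoly = A.charpoly := by
    have h := charpoly_units_conj D A
    rwa [← coe_units_inv] at h
  refine ⟨hSH.eigenvalues, fun i a => hSH.eigenvectorBasis i a / √(m a), ?_, ?_, ?_, ?_, ?_⟩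
  · rw [← hchar]; exact hSH.splits_charpoly
  · rw [← hchar]; exact hSH.roots_charpoly_eq_eigenvalues
  · intro i
    funext a
    have h := congrFun (hSH.mulVec_eigenvectorBasis i) a
    simp only [mulVec, dotProduct, Pi.smul_apply, smul_eq_mul, hSapp] at h ⊢
    rw [mul_div_assoc', ← h, Finset.sum_div]
    refine Finset.sum_congr rfl fun b _ => ?_
    field_simp [hs0 a, hs0 b]
  · intro i j
    rw [← (orthonormal_iff_ite.mp hSH.eigenvectorBasis.orthonormal) i j]
    simp only [PiLp.inner_apply, RCLike.inner_apply, conj_trivial]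
    refine Finset.sum_congr rfl fun a _ => ?_
    nth_rewrite 1 [← hss a]
    field_simp [hs0 a]
  · intro f g
    have h := hSH.eigenvectorBasis.sum_inner_mul_inner
      (WithLp.toLp 2 fun a => √(m a) * f a) (WithLp.toLp 2 fun a => √(m a) * g a)
    simp only [PiLp.inner_apply, RCLike.inner_apply, conj_trivial] at h
    convert h using 1
    · refine Finset.sum_congr rfl fun i _ => ?_
      congr 1 <;>
      · refine Finset.sum_congr rfl fun a _ => ?_
        nth_rewrite 1 [← hss a]
        field_simp [hs0 a]
    · refine Finset.sum_congr rfl fun a _ => ?_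
      nth_rewrite 1 [← hss a]
      ring

theorem exists_isLargestEigenvalue_weighted [Nonempty V] {A : Matrix V V ℝ} {m : V → ℝ}
    (hm : ∀ i, 0 < m i) (hA : ∀ i j, m i * A i j = m j * A j i) :
    ∃ x, IsLargestEigenvalue A x ∧ (∃ f : V → ℝ, f ≠ 0 ∧ A *ᵥ f = x • f) ∧
      ∀ f : V → ℝ, ∑ a, m a * (f a * (A *ᵥ f) a) ≤ x * ∑ a, m a * (f a * f a) := by
  obtain ⟨ev, u, hsp, hr, hu, ho, hP⟩ := exists_weighted_eigenbasis hm hA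
  obtain ⟨i, -, hi⟩ := Finset.exists_max_image Finset.univ ev Finset.univ_nonempty
  refine ⟨ev i, ⟨hsp, ?_, ?_⟩, ⟨u i, ?_, hu i⟩, fun f => ?_⟩
  · simp [hr]
  · rintro y hy
    simp only [hr, Set.mem_ofPred_eq, Multiset.mem_map, Finset.mem_val, Finset.mem_univ,
      true_and] at hy
    obtain ⟨j, rfl⟩ := hy
    exact hi j (Finset.mem_univ j)
  · intro h
    simpa [h] using ho i i
  · rw [weighted_form_eq hA hu hP, ← hP, Finset.mul_sum]
    refine Finset.sum_le_sum fun j _ => ?_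
    have : ∑ a, m a * (u j a * f a) = ∑ a, m a * (f a * u j a) :=
      Finset.sum_congr rfl fun a _ => by ring
    rw [this, ← pow_two]
    exact mul_le_mul_of_nonneg_right (hi j (Finset.mem_univ j)) (sq_nonneg _)

/-- Working with indices rather than values keeps multiplicity: `i` carries a smallest value, and
`j` a smallest one among the other indices. -/
theorem exists_sort_getElem_one {ev : V → ℝ} (hV : 1 < Fintype.card V) :
    ∃ i j, i ≠ j ∧ ev i ≤ ev j ∧ (∀ k, k ≠ i → ev j ≤ ev k) ∧
      ((Finset.univ.val.map ev).sort (· ≤ ·))[1]? = some (ev j) := by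
  have hlen : ((Finset.univ.val.map ev).sort (· ≤ ·)).length = Fintype.card V := by
    simp
  have hcoe := Multiset.sort_eq (Finset.univ.val.map ev) (· ≤ ·)
  have hsort := Multiset.pairwise_sort (Finset.univ.val.map ev) (· ≤ ·)
  match hl : (Finset.univ.val.map ev).sort (· ≤ ·) with
  | [] => rw [hl] at hlen; simp at hlen; omega
  | [a] => rw [hl] at hlen; simp at hlen; omega
  | a :: b :: l =>
    rw [hl] at hcoe hsort
    simp only [← Multiset.cons_coe] at hcoe
    have ha : a ∈ Finset.univ.val.map ev := by rw [← hcoe]; simp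
    obtain ⟨i, -, rfl⟩ := Multiset.mem_map.mp ha
    have hun : (Finset.univ : Finset V).val = i ::ₘ (Finset.univ.erase i).val := by
      rw [Finset.erase_val, Multiset.cons_erase (by simp)]
    rw [hun, Multiset.map_cons, Multiset.cons_inj_right] at hcoe
    have hb : b ∈ (Finset.univ.erase i).val.map ev := by rw [← hcoe]; simp
    obtain ⟨j, hj, rfl⟩ := Multiset.mem_map.mp hb
    rw [List.pairwise_cons, List.pairwise_cons] at hsort
    refine ⟨i, j, fun h => Finset.notMem_erase i Finset.univ (h ▸ hj), hsort.1 _ (by simp), fun k hk => ?_, by simp⟩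
    have hk' : ev k ∈ (Finset.univ.erase i).val.map ev :=
      Multiset.mem_map_of_mem _ (Finset.mem_erase.mpr ⟨hk, Finset.mem_univ k⟩)
    rw [← hcoe, Multiset.mem_cons] at hk'
    rcases hk' with h | h
    · exact h.ge
    · exact hsort.2.1 _ (by simpa using h)

/-- Constants lie in the kernel and the form is nonnegative, so 0 is the bottom eigenvalue and the
next one minimises the Rayleigh quotient orthogonally to constants. -/
theorem exists_isSecondSmallestEigenvalue_weighted (hV : 1 < Fintype.card V)
    {A : Matrix V V ℝ} {m : V → ℝ}
    (hm : ∀ i, 0 < m i) (hA : ∀ i j, m i * A i j = m j * A j i)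
    (hone : A *ᵥ 1 = 0) (hpos : ∀ f : V → ℝ, 0 ≤ ∑ a, m a * (f a * (A *ᵥ f) a)) :
    ∃ x, IsSecondSmallestEigenvalue A x ∧
      (∃ f : V → ℝ, f ≠ 0 ∧ ∑ a, m a * f a = 0 ∧ A *ᵥ f = x • f) ∧
      ∀ f : V → ℝ, ∑ a, m a * f a = 0 →
        x * ∑ a, m a * (f a * f a) ≤ ∑ a, m a * (f a * (A *ᵥ f) a) := by
  obtain ⟨ev, u, hsp, hr, hu, ho, hP⟩ := exists_weighted_eigenbasis hm hA
  obtain ⟨i, j, hij, hle, hmin, hsort⟩ := exists_sort_getElem_one (ev := ev) hV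
  have hev : ∀ k, 0 ≤ ev k := fun k => by
    have h := hpos (u k)
    have h' : ∑ a, m a * (u k a * (A *ᵥ u k) a) = ev k * ∑ a, m a * (u k a * u k a) := by
      rw [hu, Finset.mul_sum]
      exact Finset.sum_congr rfl fun a _ => by simp only [Pi.smul_apply, smul_eq_mul]; ring
    rw [h', ho] at h
    simpa using h
  have hu0 : ∀ k, u k ≠ 0 := fun k h => by simpa [h] using ho k k
  -- Self-adjointness against the constant 1, which `A` kills.
  have hw : ∀ k, ev k * ∑ a, m a * u k a = 0 := fun k => by
    have h := weighted_self_adjoint hA 1 (u k)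
    rw [hone, hu] at h
    simp only [Pi.one_apply, one_mul, Pi.zero_apply, zero_mul, mul_zero, Finset.sum_const_zero,
      Pi.smul_apply, smul_eq_mul] at h
    rw [Finset.mul_sum, ← h]
    exact Finset.sum_congr rfl fun a _ => by ring
  refine ⟨ev j, ⟨hsp, by rw [hr]; exact hsort⟩, ?_⟩
  rcases (hev j).eq_or_lt with h0 | hlt
  · have hi0 : ev i = 0 := le_antisymm (hle.trans h0.ge) (hev i)
    refine ⟨?_, fun f _ => by rw [← h0, zero_mul]; exact hpos f⟩
    simp only [← h0, zero_smul]
    by_cases hz : ∑ a, m a * u j a = 0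
    · exact ⟨u j, hu0 j, hz, by rw [hu, ← h0, zero_smul]⟩
    -- The kernel contains both `u i` and `u j`; this combination of them is orthogonal to
    -- constants, and its coefficient on `u i` is nonzero.
    · refine ⟨(∑ a, m a * u j a) • u i - (∑ a, m a * u i a) • u j, fun h => hz ?_, ?_, ?_⟩
      · have h1 : ∑ a, m a * (((∑ a, m a * u j a) • u i - (∑ a, m a * u i a) • u j) a * u i a) =
            (∑ a, m a * u j a) * (∑ a, m a * (u i a * u i a)) -
              (∑ a, m a * u i a) * ∑ a, m a * (u j a * u i a) := by
          rw [Finset.mul_sum, Finset.mul_sum, ← Finset.sum_sub_distrib]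
          refine Finset.sum_congr rfl fun a _ => ?_
          simp only [Pi.sub_apply, Pi.smul_apply, smul_eq_mul]; ring
        rw [h, ho, ho, if_pos rfl, if_neg hij.symm] at h1
        simpa using h1.symm
      · have h1 : ∀ α β : ℝ, ∑ a, m a * (α • u i - β • u j) a =
            α * (∑ a, m a * u i a) - β * ∑ a, m a * u j a := by
          intro α β
          rw [Finset.mul_sum, Finset.mul_sum, ← Finset.sum_sub_distrib]
          refine Finset.sum_congr rfl fun a _ => ?_
          simp only [Pi.sub_apply, Pi.smul_apply, smul_eq_mul]; ring
        rw [h1]; ring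
      · rw [mulVec_sub, mulVec_smul, mulVec_smul, hu, hu, hi0, ← h0]; simp
  -- Now 0 is at most a simple eigenvalue, so constants are multiples of `u i`, and orthogonality to
  -- one is orthogonality to the other.
  · have hwk : ∀ k, k ≠ i → ∑ a, m a * u k a = 0 := fun k hk =>
      (mul_eq_zero.mp (hw k)).resolve_left (hlt.trans_le (hmin k hk)).ne'
    refine ⟨⟨u j, hu0 j, hwk j hij.symm, hu j⟩, fun f hf => ?_⟩
    have hexp : ∀ f : V → ℝ, ∑ a, m a * f a = (∑ a, m a * (f a * u i a)) * ∑ a, m a * u i a := by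
      intro f
      have h := hP f 1
      simp only [Pi.one_apply, mul_one] at h
      rw [← h]
      refine Finset.sum_eq_single_of_mem i (Finset.mem_univ i) fun k _ hk => ?_
      rw [hwk k hk, mul_zero]
    have hwi : ∑ a, m a * u i a ≠ 0 := by
      intro h
      have h1 := hexp 1
      rw [h, mul_zero] at h1
      have : 0 < ∑ a, m a * (1 : V → ℝ) a :=
        Finset.sum_pos (fun a _ => by simpa using hm a) ⟨i, Finset.mem_univ i⟩
      exact this.ne' h1
    have hfi : ∑ a, m a * (f a * u i a) = 0 := by
      have h := hexp f
      rw [hf] at h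
      exact (mul_eq_zero.mp h.symm).resolve_right hwi
    rw [weighted_form_eq hA hu hP, ← hP, Finset.mul_sum]
    refine Finset.sum_le_sum fun k _ => ?_
    have : ∑ a, m a * (u k a * f a) = ∑ a, m a * (f a * u k a) :=
      Finset.sum_congr rfl fun a _ => by ring
    rw [this, ← pow_two]
    by_cases hk : k = i
    · rw [hk, hfi]; simp
    · exact mul_le_mul_of_nonneg_right (hmin k hk) (sq_nonneg _)

end Reversible

/-! ### Quadratic form of a weighted Laplacian and test vectors -/

section WeightedLaplacian

variable {V : Type*} [Fintype V] [DecidableEq V] (G : SimpleGraph V) [DecidableRel G.Adj]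
  (m : V → ℝ)

theorem weightedLaplacian_mulVec (g : V → ℝ) (d : V) :
    (weightedLaplacian G m *ᵥ g) d = ∑ e, if G.Adj d e then m e * (g d - g e) else 0 := by
  have h : ∀ e, weightedLaplacian G m d e =
      (if d = e then ∑ r ∈ G.neighborFinset d, m r else 0) - if G.Adj d e then m e else 0 := by
    intro e
    simp only [weightedLaplacian, of_apply]
    by_cases hde : d = e
    · subst hde; simp
    · by_cases ha : G.Adj d e <;> simp [hde, ha]
  have hK : ∑ r ∈ G.neighborFinset d, m r = ∑ e, if G.Adj d e then m e else 0 := by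
    rw [← Finset.sum_filter, G.neighborFinset_eq_filter]
  simp only [mulVec, dotProduct, h, sub_mul, ite_mul, zero_mul, Finset.sum_sub_distrib]
  rw [Finset.sum_ite_eq, if_pos (Finset.mem_univ d), hK, Finset.sum_mul,
    ← Finset.sum_sub_distrib]
  refine Finset.sum_congr rfl fun e _ => ?_
  split_ifs <;> ring

theorem weightedLaplacian_one : weightedLaplacian G (fun _ => 1) = G.lapMatrix ℝ := by
  ext i j
  by_cases hij : i = j
  · subst hij
    simp [weightedLaplacian, SimpleGraph.lapMatrix, SimpleGraph.degMatrix]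
  · simp only [weightedLaplacian, of_apply, SimpleGraph.lapMatrix, SimpleGraph.degMatrix,
      Matrix.sub_apply, diagonal_apply_ne _ hij, SimpleGraph.adjMatrix_apply, if_neg hij]
    split_ifs <;> simp

theorem weightedLaplacian_detailed_balance (i j : V) :
    m i * weightedLaplacian G m i j = m j * weightedLaplacian G m j i := by
  simp only [weightedLaplacian, of_apply, G.adj_comm j i]
  by_cases hij : i = j
  · subst hij; rfl
  · simp only [hij, Ne.symm hij, if_false]
    split_ifs <;> ring

theorem weightedLaplacian_mulVec_one : weightedLaplacian G m *ᵥ 1 = 0 := by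
  funext d
  simp [weightedLaplacian_mulVec]

/-- Summation by parts; the factor 2 appears because each edge is counted in both orientations. -/
theorem two_mul_weightedLaplacian_form (g : V → ℝ) :
    2 * ∑ a, m a * (g a * (weightedLaplacian G m *ᵥ g) a) =
      ∑ a, ∑ b, if G.Adj a b then m a * m b * (g a - g b) ^ 2 else 0 := by
  have h : ∑ a, m a * (g a * (weightedLaplacian G m *ᵥ g) a) =
      ∑ a, ∑ b, if G.Adj a b then m a * m b * (g a * (g a - g b)) else 0 := by
    refine Finset.sum_congr rfl fun a _ => ?_
    rw [weightedLaplacian_mulVec, Finset.mul_sum, Finset.mul_sum]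
    refine Finset.sum_congr rfl fun b _ => ?_
    split_ifs <;> ring
  rw [two_mul]
  nth_rewrite 2 [h]
  rw [Finset.sum_comm, h, ← Finset.sum_add_distrib]
  refine Finset.sum_congr rfl fun a _ => ?_
  rw [← Finset.sum_add_distrib]
  refine Finset.sum_congr rfl fun b _ => ?_
  simp only [G.adj_comm b a]
  split_ifs <;> ring

variable {m}

theorem weightedLaplacian_form_nonneg (hm : ∀ i, 0 < m i) (g : V → ℝ) :
    0 ≤ ∑ a, m a * (g a * (weightedLaplacian G m *ᵥ g) a) := by
  have h := two_mul_weightedLaplacian_form G m g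
  have : 0 ≤ ∑ a, ∑ b, if G.Adj a b then m a * m b * (g a - g b) ^ 2 else 0 := by
    refine Finset.sum_nonneg fun a _ => Finset.sum_nonneg fun b _ => ?_
    have := hm a
    have := hm b
    split_ifs <;> positivity
  linarith

/-- The edges at a single vertex bound the quadratic form of a weighted Laplacian from below. -/
theorem star_le_weightedLaplacian_form (hm : ∀ i, 0 < m i) (g : V → ℝ) (d : V) :
    ∑ b, (if G.Adj d b then m d * m b * (g d - g b) ^ 2 else 0) ≤
      ∑ a, m a * (g a * (weightedLaplacian G m *ᵥ g) a) := by
  have h := two_mul_weightedLaplacian_form G m g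
  set t : V → V → ℝ := fun a b => if G.Adj a b then m a * m b * (g a - g b) ^ 2 else 0 with ht
  have ht0 : ∀ a b, 0 ≤ t a b := fun a b => by
    have := hm a
    have := hm b
    simp only [ht]
    split_ifs <;> positivity
  have hsymm : ∀ a b, t a b = t b a := fun a b => by
    simp only [ht, G.adj_comm b a]
    split_ifs <;> ring
  have hdd : t d d = 0 := by simp [ht]
  change ∑ b, t d b ≤ _
  change _ = ∑ a, ∑ b, t a b at h
  -- Edges at `d` appear in both row and column `d`, which absorbs the factor 2.
  have h1 : ∑ a ∈ Finset.univ.erase d, t d a ≤ ∑ a ∈ Finset.univ.erase d, ∑ b, t a b := by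
    refine Finset.sum_le_sum fun a _ => ?_
    rw [hsymm]
    exact Finset.single_le_sum (fun b _ => ht0 a b) (Finset.mem_univ d)
  have h2 := Finset.sum_erase_add Finset.univ (fun a => ∑ b, t a b) (Finset.mem_univ d)
  have h3 := Finset.sum_erase_add Finset.univ (fun a => t d a) (Finset.mem_univ d)
  simp only [hdd, add_zero] at h2 h3
  linarith

/-- An upper bound `x` for the Rayleigh quotients of a weighted Laplacian exceeds the total weight
of every non-isolated vertex together with its neighbours. -/
theorem weight_closed_neighbourhood_le (hm : ∀ i, 0 < m i) {x : ℝ}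
    (hx : ∀ g : V → ℝ, ∑ a, m a * (g a * (weightedLaplacian G m *ᵥ g) a) ≤
      x * ∑ a, m a * (g a * g a)) {d e : V} (hde : G.Adj d e) :
    m d + ∑ b, (if G.Adj d b then m b else 0) ≤ x := by
  set M : ℝ := ∑ b, (if G.Adj d b then m b else 0) with hM
  have hMpos : 0 < M := by
    refine Finset.sum_pos' (fun b _ => ?_) ⟨e, Finset.mem_univ e, by simpa [hde] using hm e⟩
    have := hm b
    split_ifs <;> positivity
  have hmd := hm d
  -- On the weighted star at `d` alone this is an eigenvector with eigenvalue `m d + M`.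
  set g : V → ℝ := fun b => if b = d then M else if G.Adj d b then -m d else 0 with hg
  have h1 := (star_le_weightedLaplacian_form G hm g d).trans (hx g)
  have h2 : ∑ b, (if G.Adj d b then m d * m b * (g d - g b) ^ 2 else 0) =
      m d * (m d + M) ^ 2 * M := by
    rw [hM, Finset.mul_sum, ← hM]
    refine Finset.sum_congr rfl fun b _ => ?_
    by_cases hb : G.Adj d b
    · simp only [hg, hb, hb.ne', if_true, if_false]; ring
    · simp [hb]
  have h3 : ∑ a, m a * (g a * g a) = m d * M * (m d + M) := by
    have : ∀ a, m a * (g a * g a) = (if a = d then m d * (M * M) else 0) +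
        (m d) ^ 2 * if G.Adj d a then m a else 0 := by
      intro a
      by_cases ha : a = d
      · subst ha; simp [hg]
      · by_cases hb : G.Adj d a
        · simp only [hg, ha, hb, if_true, if_false]; ring
        · simp [hg, ha, hb]
    simp only [this, Finset.sum_add_distrib, ← Finset.mul_sum, Finset.sum_ite_eq',
      Finset.mem_univ, if_true, ← hM]
    ring
  rw [h2, h3] at h1
  have hpos : 0 < m d * M * (m d + M) := by positivity
  refine le_of_mul_le_mul_right ?_ hpos
  linarith

/-- If `q` is the only neighbour of `p`, then the weight of `q` bounds the Rayleigh quotient of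
some vector orthogonal to the constants. -/
theorem le_weight_of_unique_neighbour (hm : ∀ i, 0 < m i) {x : ℝ}
    (hx : ∀ g : V → ℝ, ∑ a, m a * g a = 0 →
      x * ∑ a, m a * (g a * g a) ≤ ∑ a, m a * (g a * (weightedLaplacian G m *ᵥ g) a))
    {p q r : V} (hpq : ∀ e, G.Adj p e ↔ e = q) (hrp : r ≠ p) (hrq : r ≠ q) : x ≤ m q := by
  have hqp : q ≠ p := ((hpq q).mpr rfl).ne'
  set a : ℝ := ∑ e, if e = p ∨ e = q then 0 else m e with ha
  have hapos : 0 < a := by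
    refine Finset.sum_pos' (fun b _ => ?_) ⟨r, Finset.mem_univ r, by simpa [hrp, hrq] using hm r⟩
    have := hm b
    split_ifs <;> positivity
  have hmp := hm p
  -- The weight `a` off `p` and `q` balances the value `-m p` there, so `g` is orthogonal to
  -- constants.
  set g : V → ℝ := fun b => if b = p then a else if b = q then 0 else -m p with hg
  have hgp : g p = a := by simp [hg]
  have hgq : g q = 0 := by simp [hg, hqp]
  have hgr : ∀ b, b ≠ p → b ≠ q → g b = -m p := fun b h1 h2 => by simp [hg, h1, h2]
  have hsum : ∑ b, m b * g b = 0 := by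
    have : ∀ b, m b * g b = (if b = p then m p * a else 0) -
        m p * if b = p ∨ b = q then 0 else m b := by
      intro b
      by_cases h1 : b = p
      · subst h1; simp [hgp]
      · by_cases h2 : b = q
        · subst h2; simp [hgq, h1]
        · simp only [hgr b h1 h2, h1, h2, or_self, if_false]; ring
    simp only [this, Finset.sum_sub_distrib, ← Finset.mul_sum, Finset.sum_ite_eq',
      Finset.mem_univ, if_true, ← ha, sub_self]
  have hle : ∑ b, m b * (g b * (weightedLaplacian G m *ᵥ g) b) ≤
      m q * ∑ b, m b * (g b * g b) := by
    rw [Finset.mul_sum]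
    refine Finset.sum_le_sum fun b _ => ?_
    have hmb := hm b
    have hmq := hm q
    suffices h : g b * (weightedLaplacian G m *ᵥ g) b ≤ m q * (g b * g b) by
      calc _ ≤ m b * (m q * (g b * g b)) := mul_le_mul_of_nonneg_left h hmb.le
        _ = _ := by ring
    rw [weightedLaplacian_mulVec]
    by_cases h1 : b = p
    · subst h1
      simp only [hpq, Finset.sum_ite_eq', Finset.mem_univ, if_true, hgq, sub_zero]
      exact le_of_eq (by ring)
    · by_cases h2 : b = q
      · subst h2; simp [hgq]
      -- Such a `b` is not adjacent to `p`, and `g` is constant off `p` and `q`, so only the edge to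
      -- `q` can contribute.
      · rw [Finset.sum_eq_single_of_mem q (Finset.mem_univ q)]
        · rw [hgq, sub_zero]
          have := mul_nonneg hmq.le (mul_self_nonneg (g b))
          split_ifs
          · exact le_of_eq (by ring)
          · simpa using this
        · intro c _ hc
          split_ifs with hbc
          · have hcp : c ≠ p := fun h => h2 ((hpq b).mp (h ▸ hbc.symm))
            rw [hgr b h1 h2, hgr c hcp hc]; ring
          · rfl
  have hpos : 0 < ∑ b, m b * (g b * g b) := by
    refine Finset.sum_pos' (fun b _ => mul_nonneg (hm b).le (mul_self_nonneg _))
      ⟨p, Finset.mem_univ p, ?_⟩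
    rw [hgp]; positivity
  exact le_of_mul_le_mul_right ((hx g hsum).trans hle) hpos

end WeightedLaplacian

/-! ### Adjacency given by a relation that may hold on the diagonal -/

section Relation

variable {V W : Type*} [Fintype W] [DecidableEq W] {H : SimpleGraph W} [DecidableRel H.Adj]

/-- The diagonal term vanishes, so it does not matter whether `R d d` holds. -/
theorem weightedLaplacian_mulVec_of_rel {m : W → ℝ} {R : W → W → Prop} [DecidableRel R]
    (hG : ∀ d e, H.Adj d e ↔ d ≠ e ∧ R d e)
    (g : W → ℝ) (d : W) :
    (weightedLaplacian H m *ᵥ g) d = ∑ e, if R d e then m e * (g d - g e) else 0 := by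
  rw [weightedLaplacian_mulVec]
  refine Finset.sum_congr rfl fun e _ => ?_
  by_cases hde : d = e
  · subst hde; simp
  · simp [hG, hde]

theorem lapMatrix_mulVec_of_rel {c : W → V} {R : V → V → Prop} [DecidableRel R]
    (hH : ∀ x y, H.Adj x y ↔ x ≠ y ∧ R (c x) (c y))
    (F : W → ℝ) (x : W) :
    (H.lapMatrix ℝ *ᵥ F) x = ∑ y, if R (c x) (c y) then F x - F y else 0 := by
  rw [← weightedLaplacian_one,
    weightedLaplacian_mulVec_of_rel (R := fun x y => R (c x) (c y)) hH]
  simp only [one_mul]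

end Relation

/-! ### Comparison of a graph with its weighted quotient -/

section Quotient

variable {V W : Type*} [DecidableEq V] [Fintype W] {m : V → ℝ} {c : W → V}

theorem surjective_of_fiber_card_pos (hm : ∀ d, m d = (Finset.univ.filter fun x => c x = d).card)
    (hm0 : ∀ d, 0 < m d) : Function.Surjective c := by
  intro d
  have h := hm0 d
  rw [hm, Nat.cast_pos, Finset.card_pos] at h
  obtain ⟨x, hx⟩ := h
  exact ⟨x, (Finset.mem_filter.mp hx).2⟩

theorem sum_comp_eq_sum_fiber_card [Fintype V]
    (hm : ∀ d, m d = (Finset.univ.filter fun x => c x = d).card) (g : V → ℝ) :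
    ∑ x, g (c x) = ∑ d, m d * g d := by
  rw [← Finset.sum_fiberwise Finset.univ c]
  refine Finset.sum_congr rfl fun d _ => ?_
  rw [hm, Finset.sum_congr rfl fun x hx => by rw [(Finset.mem_filter.mp hx).2],
    Finset.sum_const, nsmul_eq_mul]

variable [Fintype V] [DecidableEq W]
  {H : SimpleGraph W} [DecidableRel H.Adj] {G : SimpleGraph V} [DecidableRel G.Adj]
  {R : V → V → Prop} [DecidableRel R]

/-- Functions of the class of a vertex are mapped by the Laplacian as by the weighted Laplacian of
the quotient. -/
theorem lapMatrix_mulVec_comp (hG : ∀ d e, G.Adj d e ↔ d ≠ e ∧ R d e)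
    (hH : ∀ x y, H.Adj x y ↔ x ≠ y ∧ R (c x) (c y))
    (hm : ∀ d, m d = (Finset.univ.filter fun x => c x = d).card) (g : V → ℝ) :
    H.lapMatrix ℝ *ᵥ (fun x => g (c x)) = fun x => (weightedLaplacian G m *ᵥ g) (c x) := by
  funext x
  rw [lapMatrix_mulVec_of_rel hH, weightedLaplacian_mulVec_of_rel hG,
    sum_comp_eq_sum_fiber_card hm fun e => if R (c x) e then g (c x) - g e else 0]
  refine Finset.sum_congr rfl fun e _ => ?_
  split_ifs <;> simp

/-- An eigenvector of the Laplacian either descends to the quotient, or its eigenvalue is the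
number of vertices related to the vertices in some class. -/
theorem eigenvector_descends_or (hG : ∀ d e, G.Adj d e ↔ d ≠ e ∧ R d e)
    (hH : ∀ x y, H.Adj x y ↔ x ≠ y ∧ R (c x) (c y))
    (hm : ∀ d, m d = (Finset.univ.filter fun x => c x = d).card) (hm0 : ∀ d, 0 < m d)
    {F : W → ℝ} (hF : F ≠ 0) {y : ℝ} (hy : H.lapMatrix ℝ *ᵥ F = y • F) :
    (∃ g : V → ℝ, g ≠ 0 ∧ weightedLaplacian G m *ᵥ g = y • g ∧ ∑ d, m d * g d = ∑ x, F x) ∨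
      ∃ d, y = ∑ e, if R d e then m e else 0 := by
  set T : V → ℝ := fun d => ∑ x with c x = d, F x with hT
  set k : V → ℝ := fun d => ∑ e, if R d e then m e else 0 with hk
  have heq : ∀ x, k (c x) * F x - (∑ e, if R (c x) e then T e else 0) = y * F x := by
    intro x
    have h := congrFun hy x
    rw [lapMatrix_mulVec_of_rel hH, Pi.smul_apply, smul_eq_mul] at h
    rw [← h]
    have h1 : k (c x) = ∑ y, if R (c x) (c y) then (1 : ℝ) else 0 := by
      rw [sum_comp_eq_sum_fiber_card hm fun e => if R (c x) e then (1 : ℝ) else 0]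
      exact Finset.sum_congr rfl fun e _ => by split_ifs <;> simp
    have h2 : (∑ e, if R (c x) e then T e else 0) = ∑ y, if R (c x) (c y) then F y else 0 := by
      rw [← Finset.sum_fiberwise Finset.univ c]
      refine Finset.sum_congr rfl fun e _ => ?_
      rw [Finset.sum_congr rfl fun x hx => by rw [(Finset.mem_filter.mp hx).2]]
      split_ifs <;> simp [hT]
    rw [h1, h2, Finset.sum_mul, ← Finset.sum_sub_distrib]
    exact Finset.sum_congr rfl fun e _ => by split_ifs <;> ring
  -- If all class sums vanish, `heq` at a point where `F` is nonzero reads off the eigenvalue;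
  -- otherwise the class averages `T d / m d` form the quotient eigenvector.
  by_cases hT0 : T = 0
  · right
    obtain ⟨x, hx⟩ := Function.ne_iff.mp hF
    refine ⟨c x, ?_⟩
    have h := heq x
    simp only [hT0, Pi.zero_apply, ite_self, Finset.sum_const_zero, sub_zero] at h
    exact (mul_right_cancel₀ hx h).symm
  · left
    have hmT : ∀ d, m d * (T d / m d) = T d := fun d => mul_div_cancel₀ _ (hm0 d).ne'
    refine ⟨fun d => T d / m d, fun h => hT0 ?_, ?_, ?_⟩
    · funext d
      have := congrFun h d
      simp only [Pi.zero_apply] at this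
      rw [← hmT, this, mul_zero, Pi.zero_apply]
    · funext d
      have h : k d * T d - m d * (∑ e, if R d e then T e else 0) = y * T d := by
        have h : ∑ x with c x = d, (k d * F x - ∑ e, if R d e then T e else 0) =
            ∑ x with c x = d, y * F x := by
          refine Finset.sum_congr rfl fun x hx => ?_
          rw [← heq x, (Finset.mem_filter.mp hx).2]
        rw [Finset.sum_sub_distrib, ← Finset.mul_sum, ← Finset.mul_sum, Finset.sum_const,
          nsmul_eq_mul, ← hm] at h
        exact h
      rw [weightedLaplacian_mulVec_of_rel hG, Pi.smul_apply, smul_eq_mul]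
      have h' : (∑ e, if R d e then m e * (T d / m d - T e / m e) else 0) =
          k d * (T d / m d) - ∑ e, if R d e then T e else 0 := by
        rw [Finset.sum_mul, ← Finset.sum_sub_distrib]
        refine Finset.sum_congr rfl fun e _ => ?_
        split_ifs
        · rw [mul_sub, hmT]
        · simp
      rw [h']
      have := (hm0 d).ne'
      field_simp
      linarith
    · simp only [hmT]
      exact Finset.sum_fiberwise Finset.univ c F

/-- Lifting a quotient eigenvector bounds `y` by `x`; descending one bounds `x` by `y`, and an
eigenvalue that does not descend is at least `m q`, hence at least `x`. -/
theorem exists_algebraicConnectivity_eq (hG : ∀ d e, G.Adj d e ↔ d ≠ e ∧ R d e)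
    (hH : ∀ x y, H.Adj x y ↔ x ≠ y ∧ R (c x) (c y))
    (hm : ∀ d, m d = (Finset.univ.filter fun x => c x = d).card) (hm0 : ∀ d, 0 < m d)
    {p q r : V} (hpq : ∀ e, G.Adj p e ↔ e = q) (hrp : r ≠ p) (hrq : r ≠ q)
    (hq : ∀ d, m q ≤ ∑ e, if R d e then m e else 0) :
    ∃ μ, IsAlgebraicConnectivity H μ ∧
      IsSecondSmallestEigenvalue (weightedLaplacian G m) μ := by
  have hsurj := surjective_of_fiber_card_pos hm hm0
  have hV : 1 < Fintype.card V := Fintype.one_lt_card_iff.mpr ⟨r, p, hrp⟩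
  have hW : 1 < Fintype.card W := hV.trans_le (Fintype.card_le_of_surjective c hsurj)
  obtain ⟨x, hx, ⟨g, hg0, hgs, hgx⟩, hxR⟩ := exists_isSecondSmallestEigenvalue_weighted hV hm0
    (weightedLaplacian_detailed_balance G m) (weightedLaplacian_mulVec_one G m)
    (weightedLaplacian_form_nonneg G hm0)
  obtain ⟨y, hy, ⟨F, hF0, hFs, hFy⟩, hyR⟩ := exists_isSecondSmallestEigenvalue_weighted hW
    (fun _ => one_pos) (weightedLaplacian_detailed_balance H fun _ => 1)
    (weightedLaplacian_mulVec_one H fun _ => 1)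
    (weightedLaplacian_form_nonneg H fun _ => one_pos)
  rw [weightedLaplacian_one] at hy hFy hyR
  simp only [one_mul] at hFs hyR
  suffices hxy : y = x from ⟨y, hy, hxy ▸ hx⟩
  have hnorm : ∀ g : V → ℝ, g ≠ 0 → 0 < ∑ d, m d * (g d * g d) := fun g hg => by
    obtain ⟨d, hd⟩ := Function.ne_iff.mp hg
    exact Finset.sum_pos' (fun b _ => mul_nonneg (hm0 b).le (mul_self_nonneg _))
      ⟨d, Finset.mem_univ d, mul_pos (hm0 d) (mul_self_pos.mpr hd)⟩
  refine le_antisymm ?_ ?_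
  · have h := hyR (fun x => g (c x)) (by rw [sum_comp_eq_sum_fiber_card hm g, hgs])
    rw [lapMatrix_mulVec_comp hG hH hm, hgx] at h
    rw [sum_comp_eq_sum_fiber_card hm fun d => g d * g d,
      sum_comp_eq_sum_fiber_card hm fun d => g d * (x • g) d] at h
    refine le_of_mul_le_mul_right (h.trans_eq ?_) (hnorm g hg0)
    rw [Finset.mul_sum]
    exact Finset.sum_congr rfl fun d _ => by simp only [Pi.smul_apply, smul_eq_mul]; ring
  · rcases eigenvector_descends_or hG hH hm hm0 hF0 hFy with ⟨f, hf0, hfy, hfs⟩ | ⟨d, hd⟩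
    · have h := hxR f (hfs.trans hFs)
      rw [hfy] at h
      refine le_of_mul_le_mul_right (h.trans_eq ?_) (hnorm f hf0)
      rw [Finset.mul_sum]
      exact Finset.sum_congr rfl fun d _ => by simp only [Pi.smul_apply, smul_eq_mul]; ring
    · rw [hd]
      exact (le_weight_of_unique_neighbour G hm0 hxR hpq hrp hrq).trans (hq d)

theorem exists_laplacianSpectralRadius_eq [Nonempty V]
    (hG : ∀ d e, G.Adj d e ↔ d ≠ e ∧ R d e)
    (hH : ∀ x y, H.Adj x y ↔ x ≠ y ∧ R (c x) (c y))
    (hm : ∀ d, m d = (Finset.univ.filter fun x => c x = d).card) (hm0 : ∀ d, 0 < m d)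
    (hadj : ∀ d, ∃ e, G.Adj d e) :
    ∃ ρ, IsLaplacianSpectralRadius H ρ ∧ IsLargestEigenvalue (weightedLaplacian G m) ρ := by
  have hsurj := surjective_of_fiber_card_pos hm hm0
  have : Nonempty W := hsurj.nonempty
  obtain ⟨x, hx, ⟨g, hg0, hgx⟩, hxR⟩ := exists_isLargestEigenvalue_weighted hm0
    (weightedLaplacian_detailed_balance G m)
  obtain ⟨y, hy, ⟨F, hF0, hFy⟩, hyR⟩ := exists_isLargestEigenvalue_weighted
    (fun _ => one_pos) (weightedLaplacian_detailed_balance H fun _ => 1)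
  rw [weightedLaplacian_one] at hy hFy hyR
  simp only [one_mul] at hyR
  suffices hxy : y = x from ⟨y, hy, hxy ▸ hx⟩
  have hnorm : ∀ g : V → ℝ, g ≠ 0 → 0 < ∑ d, m d * (g d * g d) := fun g hg => by
    obtain ⟨d, hd⟩ := Function.ne_iff.mp hg
    exact Finset.sum_pos' (fun b _ => mul_nonneg (hm0 b).le (mul_self_nonneg _))
      ⟨d, Finset.mem_univ d, mul_pos (hm0 d) (mul_self_pos.mpr hd)⟩
  refine le_antisymm ?_ ?_
  · rcases eigenvector_descends_or hG hH hm hm0 hF0 hFy with ⟨f, hf0, hfy, -⟩ | ⟨d, hd⟩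
    · have h := hxR f
      rw [hfy] at h
      refine le_of_mul_le_mul_right (Eq.trans_le ?_ h) (hnorm f hf0)
      rw [Finset.mul_sum]
      exact Finset.sum_congr rfl fun d _ => by simp only [Pi.smul_apply, smul_eq_mul]; ring
    · obtain ⟨e, hde⟩ := hadj d
      refine le_trans ?_ (weight_closed_neighbourhood_le G hm0 hxR hde)
      rw [hd, ← Finset.sum_erase_add Finset.univ _ (Finset.mem_univ d), add_comm]
      refine add_le_add ?_ ?_
      -- The class of `d` itself counts only when `R d d` holds; at worst this drops `m d`.
      · split_ifs
        · exact le_rfl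
        · exact (hm0 d).le
      · rw [← Finset.sum_erase_add Finset.univ _ (Finset.mem_univ d)]
        simp only [SimpleGraph.irrefl, if_false, add_zero]
        refine le_of_eq (Finset.sum_congr rfl fun b hb => ?_)
        simp [hG, (Finset.ne_of_mem_erase hb).symm]
  · have h := hyR (fun x => g (c x))
    rw [lapMatrix_mulVec_comp hG hH hm, hgx] at h
    rw [sum_comp_eq_sum_fiber_card hm fun d => g d * g d,
      sum_comp_eq_sum_fiber_card hm fun d => g d * (x • g) d] at h
    refine le_of_mul_le_mul_right (Eq.trans_le ?_ h) (hnorm g hg0)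
    rw [Finset.mul_sum]
    exact Finset.sum_congr rfl fun d _ => by simp only [Pi.smul_apply, smul_eq_mul]; ring

end Quotient

/-! ### Zero divisors of `ZMod n` sorted by gcd -/

section ZeroDivisor

variable {n : ℕ}

theorem mem_properDivisor_iff {d : ℕ} :
    d ∈ (Finset.Ioo 1 n).filter (fun d => d ∣ n) ↔ (1 < d ∧ d < n) ∧ d ∣ n := by
  rw [Finset.mem_filter, Finset.mem_Ioo]

theorem dvd_mul_iff_dvd_gcd_mul_gcd {a b : ℕ} : n ∣ a * b ↔ n ∣ n.gcd a * n.gcd b := by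
  rw [← Nat.dvd_gcd_mul_iff_dvd_mul, ← Nat.dvd_mul_gcd_iff_dvd_mul]

theorem div_mem_properDivisor {d : ℕ}
    (hd : d ∈ (Finset.Ioo 1 n).filter (fun d => d ∣ n)) :
    n / d ∈ (Finset.Ioo 1 n).filter (fun d => d ∣ n) := by
  rw [mem_properDivisor_iff] at hd ⊢
  obtain ⟨⟨h1, h2⟩, h3⟩ := hd
  refine ⟨⟨?_, Nat.div_lt_self (by omega) h1⟩, Nat.div_dvd_of_dvd h3⟩
  by_contra h
  have := Nat.div_mul_cancel h3
  interval_cases n / d <;> omega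

variable [NeZero n]

theorem gcd_val_mem_properDivisor (x : ZeroDivisor (ZMod n)) :
    n.gcd x.1.val ∈ (Finset.Ioo 1 n).filter (fun d => d ∣ n) := by
  obtain ⟨x, hx0, y, hy0, hxy⟩ := x
  have hn : 0 < n := NeZero.pos n
  rw [mem_properDivisor_iff]
  change (1 < n.gcd x.val ∧ n.gcd x.val < n) ∧ n.gcd x.val ∣ n
  refine ⟨⟨?_, ?_⟩, Nat.gcd_dvd_left _ _⟩
  · have h1 : n.gcd x.val ≠ 1 := fun h => by
      have hu : IsUnit x := by
        rw [← ZMod.natCast_zmod_val x, ZMod.isUnit_iff_coprime]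
        exact Nat.Coprime.symm h
      exact hy0 ((hu.mul_right_eq_zero).mp hxy)
    have := Nat.gcd_pos_of_pos_left x.val hn
    omega
  · refine lt_of_le_of_ne (Nat.gcd_le_left _ hn) fun h => hx0 ?_
    have h1 : n ∣ x.val := Nat.gcd_eq_left_iff_dvd.mp h
    exact (ZMod.val_eq_zero x).mp (Nat.eq_zero_of_dvd_of_lt h1 (ZMod.val_lt x))

/-- The proper divisor `gcd(n, x)` attached to a zero divisor `x` of `ZMod n`. -/
def zeroDivisorClass (x : ZeroDivisor (ZMod n)) : ProperDivisor n :=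
  ⟨n.gcd x.1.val, gcd_val_mem_properDivisor x⟩

theorem zeroDivisorGraph_adj_iff (x y : ZeroDivisor (ZMod n)) :
    (zeroDivisorGraph (ZMod n)).Adj x y ↔
      x ≠ y ∧ n ∣ (zeroDivisorClass x : ℕ) * (zeroDivisorClass y : ℕ) := by
  change x ≠ y ∧ x.1 * y.1 = 0 ↔ x ≠ y ∧ n ∣ n.gcd x.1.val * n.gcd y.1.val
  rw [← dvd_mul_iff_dvd_gcd_mul_gcd, ← ZMod.natCast_eq_zero_iff, Nat.cast_mul,
    ZMod.natCast_zmod_val, ZMod.natCast_zmod_val]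

/-- `φ(n/d)` counts the `k < n` with `gcd(n, k) = d`, and each such `k` is a zero divisor, being
killed by `n/d`. -/
theorem card_zeroDivisorClass_fiber (d : ProperDivisor n) :
    (n / (d : ℕ)).totient =
      (Finset.univ.filter fun x : ZeroDivisor (ZMod n) => zeroDivisorClass x = d).card := by
  obtain ⟨d, hd⟩ := d
  have hd' := mem_properDivisor_iff.mp hd
  obtain ⟨⟨h1, h2⟩, h3⟩ := hd'
  rw [Nat.totient_div_of_dvd h3]
  symm
  refine Finset.card_bij (fun x _ => x.1.val) ?_ ?_ ?_
  · intro x hx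
    rw [Finset.mem_filter] at hx ⊢
    exact ⟨Finset.mem_range.mpr (ZMod.val_lt _), congrArg Subtype.val hx.2⟩
  · intro x _ y _ h
    exact Subtype.ext (ZMod.val_injective n h)
  · intro k hk
    rw [Finset.mem_filter, Finset.mem_range] at hk
    obtain ⟨hkn, hk⟩ := hk
    have hval : (k : ZMod n).val = k := ZMod.val_cast_of_lt hkn
    have hdiv := (mem_properDivisor_iff.mp (div_mem_properDivisor hd)).1
    refine ⟨⟨(k : ZMod n), ?_, ((n / d : ℕ) : ZMod n), ?_, ?_⟩, ?_, hval⟩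
    · intro h
      rw [ZMod.natCast_eq_zero_iff] at h
      have := Nat.gcd_eq_left h
      omega
    · intro h
      rw [ZMod.natCast_eq_zero_iff] at h
      have := Nat.le_of_dvd (by omega) h
      omega
    · rw [← Nat.cast_mul, ZMod.natCast_eq_zero_iff]
      have : d ∣ k := hk ▸ Nat.gcd_dvd_right n k
      calc n = d * (n / d) := (Nat.mul_div_cancel' h3).symm
        _ ∣ k * (n / d) := mul_dvd_mul_right this _
    · rw [Finset.mem_filter]
      refine ⟨Finset.mem_univ _, Subtype.ext ?_⟩
      change n.gcd (k : ZMod n).val = d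
      rw [hval, hk]

end ZeroDivisor

/-! ### Arithmetic of the divisor graph -/

section DivisorGraph

variable {n : ℕ}

theorem totient_div_pos (d : ProperDivisor n) : (0 : ℝ) < ((n / (d : ℕ)).totient : ℝ) := by
  have := (mem_properDivisor_iff.mp (div_mem_properDivisor d.2)).1.1
  exact_mod_cast Nat.totient_pos.mpr (by omega)

/-- The codivisor `n/d` is a neighbour unless `n = d²`; then `d` is not prime, and `d` times its
least prime factor is a neighbour below `n`. -/
theorem exists_divisorGraph_adj (hn : ¬ IsPrimePow n) (d : ProperDivisor n) :
    ∃ e, (divisorGraph n).Adj d e := by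
  obtain ⟨d, hd⟩ := d
  obtain ⟨⟨h1, h2⟩, h3⟩ := mem_properDivisor_iff.mp hd
  by_cases h : n / d = d
  · have hnd : n = d * d := by
      nth_rewrite 2 [← h]
      exact (Nat.mul_div_cancel' h3).symm
    have hdp : ¬ d.Prime := fun hp =>
      hn ((isPrimePow_nat_iff n).mpr ⟨d, 2, hp, two_pos, by rw [hnd, sq]⟩)
    have hp := Nat.minFac_prime (n := d) (by omega)
    have hlt : d.minFac < d := (Nat.not_prime_iff_minFac_lt h1).mp hdp
    refine ⟨⟨d * d.minFac, mem_properDivisor_iff.mpr ⟨⟨?_, ?_⟩, ?_⟩⟩, ?_, ?_⟩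
    · nlinarith [hp.two_le]
    · rw [hnd]; exact Nat.mul_lt_mul_of_pos_left hlt (by omega)
    · rw [hnd]; exact mul_dvd_mul_left _ (Nat.minFac_dvd d)
    · intro h
      have : d = d * d.minFac := congrArg Subtype.val h
      nlinarith [hp.two_le]
    · change n ∣ d * (d * d.minFac)
      rw [← mul_assoc, ← hnd]
      exact dvd_mul_right _ _
  · refine ⟨⟨n / d, div_mem_properDivisor hd⟩, fun h' => h (congrArg Subtype.val h').symm, ?_⟩
    change n ∣ d * (n / d)
    rw [Nat.mul_div_cancel' h3]

/-- For a prime `p` whose square is not `n`, the only neighbour of `p` is `n / p`. -/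
theorem divisorGraph_adj_prime_iff {p : ℕ} (hp : p.Prime)
    (hpn : p ∈ (Finset.Ioo 1 n).filter (fun d => d ∣ n)) (hsq : n ≠ p * p)
    (e : ProperDivisor n) :
    (divisorGraph n).Adj ⟨p, hpn⟩ e ↔ e = ⟨n / p, div_mem_properDivisor hpn⟩ := by
  have h3 := (mem_properDivisor_iff.mp hpn).2
  have hmul := Nat.mul_div_cancel' h3
  constructor
  · rintro ⟨-, h⟩
    change n ∣ p * (e : ℕ) at h
    obtain ⟨e, he⟩ := e
    obtain ⟨⟨h4, h5⟩, h6⟩ := mem_properDivisor_iff.mp he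
    refine Subtype.ext ?_
    change e = n / p
    have h7 : n / p ∣ e := by
      refine Nat.dvd_of_mul_dvd_mul_left hp.pos ?_
      rwa [hmul]
    obtain ⟨t, rfl⟩ := h7
    have hq : 0 < n / p := Nat.pos_of_ne_zero fun h0 => by simp [h0] at h4
    have ht : t ∣ p := by
      have : n / p * t ∣ n / p * p := by rwa [mul_comm (n / p) p, hmul]
      exact Nat.dvd_of_mul_dvd_mul_left hq this
    rcases (Nat.dvd_prime hp).mp ht with rfl | rfl
    · exact mul_one _
    · rw [mul_comm, hmul] at h5
      exact absurd h5 (lt_irrefl _)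
  · rintro rfl
    refine ⟨fun h => hsq ?_, ?_⟩
    · have : p = n / p := congrArg Subtype.val h
      rw [← this] at hmul
      exact hmul.symm
    · change n ∣ p * (n / p)
      rw [hmul]

/-- For the least prime `r` of `d`, the divisor `n/r` is related to `d` and has weight `r - 1`, at
least the totient of the least prime of `n`. -/
theorem totient_minFac_le_sum_totient (d : ProperDivisor n) :
    ((n.minFac.totient : ℕ) : ℝ) ≤ ∑ e : ProperDivisor n,
      if n ∣ (d : ℕ) * (e : ℕ) then ((n / (e : ℕ)).totient : ℝ) else 0 := by
  obtain ⟨d, hd⟩ := d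
  obtain ⟨⟨h1, h2⟩, h3⟩ := mem_properDivisor_iff.mp hd
  have hr := Nat.minFac_prime (n := d) (by omega)
  have hrn : d.minFac ∣ n := (Nat.minFac_dvd d).trans h3
  have hmem : d.minFac ∈ (Finset.Ioo 1 n).filter (fun d => d ∣ n) :=
    mem_properDivisor_iff.mpr
      ⟨⟨hr.one_lt, (Nat.minFac_le (by omega)).trans_lt h2⟩, hrn⟩
  have hdvd : n ∣ d * (n / d.minFac) := by
    nth_rewrite 1 [← Nat.mul_div_cancel' hrn]
    exact mul_dvd_mul_right (Nat.minFac_dvd d) _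
  refine le_trans ?_ (Finset.single_le_sum (fun e _ => ?_)
    (Finset.mem_univ (⟨n / d.minFac, div_mem_properDivisor hmem⟩ : ProperDivisor n)))
  · simp only [hdvd, if_true]
    rw [Nat.div_div_self hrn (by omega), Nat.totient_prime hr,
      Nat.totient_prime (Nat.minFac_prime (by omega))]
    exact_mod_cast Nat.sub_le_sub_right (Nat.minFac_le_of_dvd hr.two_le hrn) 1
  · split_ifs <;> positivity

theorem exists_prime_dvd_ne_minFac (h1 : n ≠ 1) (hn : ¬ IsPrimePow n) :
    ∃ u, u.Prime ∧ u ∣ n ∧ u ≠ n.minFac := by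
  by_contra! h
  exact hn (isPrimePow_iff_unique_prime_dvd.mpr
    ⟨n.minFac, ⟨Nat.minFac_prime h1, Nat.minFac_dvd n⟩, fun u hu => h u hu.1 hu.2⟩)

theorem prime_mem_properDivisor [NeZero n] (hn : ¬ IsPrimePow n) {p : ℕ} (hp : p.Prime)
    (hpn : p ∣ n) : p ∈ (Finset.Ioo 1 n).filter (fun d => d ∣ n) :=
  mem_properDivisor_iff.mpr ⟨⟨hp.one_lt, lt_of_le_of_ne (Nat.le_of_dvd (NeZero.pos n) hpn)
    fun h => hn (h ▸ hp.isPrimePow)⟩, hpn⟩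

end DivisorGraph

theorem theorem5p7 (n : ℕ) [NeZero n] (hn : n ≠ 1) :
    (¬ IsPrimePow n → ¬ (∃ p q : ℕ, p.Prime ∧ q.Prime ∧ p ≠ q ∧ n = p * q) →
      ∃ μ : ℝ, IsAlgebraicConnectivity (zeroDivisorGraph (ZMod n)) μ ∧
        IsSecondSmallestEigenvalue (divisorLaplacian n) μ) ∧
    (¬ IsPrimePow n →
      ∃ ρ : ℝ, IsLaplacianSpectralRadius (zeroDivisorGraph (ZMod n)) ρ ∧
        IsLargestEigenvalue (divisorLaplacian n) ρ) := by
  have hG : ∀ d e : ProperDivisor n,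
      (divisorGraph n).Adj d e ↔ d ≠ e ∧ n ∣ (d : ℕ) * (e : ℕ) := fun _ _ => Iff.rfl
  have hm : ∀ d : ProperDivisor n, ((n / (d : ℕ)).totient : ℝ) =
      (Finset.univ.filter fun x : ZeroDivisor (ZMod n) => zeroDivisorClass x = d).card :=
    fun d => by rw [card_zeroDivisorClass_fiber]
  have hp := Nat.minFac_prime hn
  have hpn := Nat.minFac_dvd n
  constructor
  · intro hpow hpq
    have hmem := prime_mem_properDivisor hpow hp hpn
    have hsq : n ≠ n.minFac * n.minFac := fun h =>
      hpow ((isPrimePow_nat_iff n).mpr ⟨n.minFac, 2, hp, two_pos, by rw [sq, ← h]⟩)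
    obtain ⟨u, hu, hun, hup⟩ := exists_prime_dvd_ne_minFac hn hpow
    refine exists_algebraicConnectivity_eq (R := fun d e => n ∣ (d : ℕ) * (e : ℕ))
      (r := ⟨u, prime_mem_properDivisor hpow hu hun⟩) hG zeroDivisorGraph_adj_iff hm
      totient_div_pos (divisorGraph_adj_prime_iff hp hmem hsq) ?_ ?_ fun d => ?_
    · exact fun h => hup (congrArg Subtype.val h)
    -- A third vertex besides `p` and `n/p` is needed: another prime `u` serves unless `n = p * u`,
    -- the excluded case.
    · intro h
      have h' : u = n / n.minFac := congrArg Subtype.val h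
      exact hpq ⟨n.minFac, u, hp, hu, hup.symm, by rw [h', Nat.mul_div_cancel' hpn]⟩
    · refine le_trans (le_of_eq ?_) (totient_minFac_le_sum_totient d)
      simp only [Nat.div_div_self hpn (NeZero.ne n)]
  · intro hpow
    have : Nonempty (ProperDivisor n) := ⟨⟨_, prime_mem_properDivisor hpow hp hpn⟩⟩
    exact exists_laplacianSpectralRadius_eq (R := fun d e => n ∣ (d : ℕ) * (e : ℕ))
      hG zeroDivisorGraph_adj_iff hm totient_div_pos (exists_divisorGraph_adj hpow)
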